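/- Let $s=(s_n)_{n\ge 0}$ be a sequence of real numbers that is not identically zero. For $n\ge 0$ let $D_n=\det(s_{i+j})_{i,j=0}^{n}$. For $n\ge 0$ let $D'_{n+1}$ be the determinant of order $n+1$ obtained from the matrix $(s_{i+j})_{i,j=0}^{n+1}$ by deleting its last row and its last column but one. For $n\ge 1$ let $P_n(x)$ (respectively $Q_n(x)$) be the determinant of the matrix obtained from $(s_{i+j})_{i,j=0}^{n}$ by replacing the last row by $1,x,\dots,x^n$ (respectively by $0,\ s_0,\ s_0x+s_1,\ \dots,\ \sum_{k=0}^{n-1}s_kx^{n-1-k}$). The rank of an infinite matrix $(a_{i,j})_{i,j\ge 0}$ is the supremum over $n\geq 0$ of the ranks of $(a_{i,j})_{i,j=0}^{n}$. Let $N_s=\{r\ge 1: D_{r-1}\ne 0\}$. For $r\in N_s$ let $(d^{(r)}_0,\dots,d^{(r)}_{r-1})$ be the unique solution of the linear system $\sum_{k=0}^{r-1}s_{i+k}d^{(r)}_k=s_{r+i}$, $0\le i\le r-1$. The Iohvidov approximating sequence $s^{(r)}=(s^{(r)}_n)_{n\ge 0}$ is defined by $s^{(r)}_n=s_n$ for $0\le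 n\le 2r-1$ and, recursively, $s^{(r)}_{2r+m}=\sum_{k=0}^{r-1}s^{(r)}_{r+m+k}d^{(r)}_k$ for $m\ge 0$. The Iohvidov characteristic is $d_r=\inf\{m\ge 0: s_{2r+m}\ne s^{(r)}_{2r+m}\}\in\{0,1,2,\dots\}\cup\{\infty\}$, where $\inf\emptyset=\infty$. Then the following statements hold. (a) For every $n\ge 1$: $s_0=\dots=s_{n-1}=0$ and $s_n\ne 0$ if and only if $D_0=\dots=D_{n-1}=0$ and $D_n\ne 0$. Moreover, if $n\ge 1$ and $D_0=\dots=D_{n-1}=0$, then $D_n=(-1)^{n(n+1)/2}s_n^{n+1}$. (b) The set $N_s$ is nonempty, and for every $r\in N_s$ the infinite Hankel matrix $(s^{(r)}_{i+j})_{i,j=0}^{\infty}$ has rank $r$. (c) For every $r\in N_s$ the number $\rho_r=\max\{|z|: z\in\mathbb C,\ P_r(z)=0\}$ exists, $$\limsup_{k\to\infty}\sqrt[k]{|s^{(r)}_k|}=\rho_r,$$ and for every $x\in\mathbb C$ with $|x|>\rho_r$ $$\sum_{k\ge 0}\frac{s^{(r)}_k}{x^{k+1}}=\frac{Q_r(x)}{P_r(x)},$$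 where the series converges absolutely. (d) For every $r\in N_s$, $$D_r=(s_{2r}-s^{(r)}_{2r})D_{r-1},\qquad D'_{r+1}=(s_{2r+1}-s^{(r)}_{2r+1})D_{r-1}-(s_{2r}-s^{(r)}_{2r})D'_r .$$ For every $r\in N_s$ and every $d\ge 1$: $D_r=\dots=D_{r+d-1}=0$ if and only if $s_{2r+i}=s^{(r)}_{2r+i}$ for all $0\le i\le d-1$; and if $D_r=\dots=D_{r+d-1}=0$, then $$D_{r+d}=(-1)^{d(d+1)/2}\,(s_{2r+d}-s^{(r)}_{2r+d})^{d+1}\,D_{r-1}.$$ (e) For every $r\in N_s$ we have $d_r=\inf\{m\ge 0: D_{r+m}\ne 0\}$ (again with $\inf\emptyset=\infty$). In particular, for every $r\in N_s$, the following are equivalent: $d_r=\infty$; $s=s^{(r)}$; $D_{r-1}\neq 0$ and $D_n=0$ for all $n\ge r$. -/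

import Mathlib

open Polynomial

noncomputable section

namespace HankelDet

/-- The `n × n` Hankel matrix `(s_{i+j})`, `0 ≤ i, j ≤ n - 1`. -/
def hankel (s : ℕ → ℝ) (n : ℕ) : Matrix (Fin n) (Fin n) ℝ :=
  Matrix.of fun i j => s ((i : ℕ) + (j : ℕ))

/-- The Hankel determinant `D_n`, of order `n + 1`. -/
def D (s : ℕ → ℝ) (n : ℕ) : ℝ := (hankel s (n + 1)).det

/-- `D'_{n+1}`: the minor of the matrix of `D_{n+1}` obtained by deleting the last row and the last
column but one; by convention `D'_0 = 0`. -/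
def D' (s : ℕ → ℝ) : ℕ → ℝ
  | 0 => 0
  | n + 1 => ((hankel s (n + 2)).submatrix
      (Fin.last (n + 1)).succAbove (Fin.last n).castSucc.succAbove).det

/-- The set of all `r ≥ 1` with `D_{r-1} ≠ 0`. -/
def indexSet (s : ℕ → ℝ) : Set ℕ := {r | 1 ≤ r ∧ D s (r - 1) ≠ 0}

/-- The Hankel determinant polynomial `P_n`: the matrix of `D_n` with its last row replaced by
`1, x, …, x^n`. -/
def P (s : ℕ → ℝ) (n : ℕ) : ℝ[X] :=
  (Matrix.of fun i j : Fin (n + 1) =>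
    if (i : ℕ) < n then C (s ((i : ℕ) + (j : ℕ))) else X ^ (j : ℕ)).det

/-- The polynomial `Q_n`: the matrix of `D_n` with its last row replaced by
`0, s_0, s_0 x + s_1, …, ∑_{k<n} s_k x^{n-1-k}`. -/
def Q (s : ℕ → ℝ) (n : ℕ) : ℝ[X] :=
  (Matrix.of fun i j : Fin (n + 1) =>
    if (i : ℕ) < n then C (s ((i : ℕ) + (j : ℕ)))
    else ∑ k ∈ Finset.range (j : ℕ), C (s k) * X ^ ((j : ℕ) - 1 - k)).det

/-- The solution `d_0, …, d_{r-1}` of the linear system `∑_k s_{i+k} d_k = s_{r+i}`,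
`0 ≤ i ≤ r - 1`, whose matrix is invertible when `D_{r-1} ≠ 0`. -/
def iohvidovCoeff (s : ℕ → ℝ) (r : ℕ) : Fin r → ℝ :=
  (hankel s r)⁻¹.mulVec fun i : Fin r => s (r + (i : ℕ))

/-- The Iohvidov approximating sequence `s^{(r)}`: it agrees with `s` up to index `2r - 1` and
satisfies `s^{(r)}_n = ∑_k s^{(r)}_{n-r+k} d_k` for `n ≥ 2r`. -/
def approx (s : ℕ → ℝ) (r : ℕ) (n : ℕ) : ℝ :=
  if _h : n < 2 * r then s n
  else ∑ k : Fin r, approx s r (n - r + (k : ℕ)) * iohvidovCoeff s r k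
termination_by n
decreasing_by have := k.2; omega

/-- If `D_{r-1} ≠ 0`, then `iohvidovCoeff s r` is the unique solution of its linear system. -/
theorem iohvidovCoeff_unique (s : ℕ → ℝ) {r : ℕ} (hr : r ∈ indexSet s) (d : Fin r → ℝ) :
    (∀ i : Fin r, ∑ k : Fin r, s ((i : ℕ) + (k : ℕ)) * d k = s (r + (i : ℕ))) ↔
      d = iohvidovCoeff s r := by
  obtain ⟨h1, h2⟩ := hr
  obtain ⟨m, rfl⟩ : ∃ m, r = m + 1 := ⟨r - 1, by omega⟩
  have hu : IsUnit (hankel s (m + 1)).det := by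
    simpa [D] using h2
  have key : (∀ i : Fin (m + 1), ∑ k : Fin (m + 1), s ((i : ℕ) + (k : ℕ)) * d k =
      s (m + 1 + (i : ℕ))) ↔
      (hankel s (m + 1)).mulVec d = fun i : Fin (m + 1) => s (m + 1 + (i : ℕ)) := by
    rw [funext_iff]; rfl
  rw [key]
  constructor
  · intro h
    rw [iohvidovCoeff, ← h, Matrix.mulVec_mulVec, Matrix.nonsing_inv_mul _ hu, Matrix.one_mulVec]
  · intro h
    rw [h]
    simp only [iohvidovCoeff]
    rw [Matrix.mulVec_mulVec, Matrix.mul_nonsing_inv _ hu, Matrix.one_mulVec]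

theorem approx_of_lt (s : ℕ → ℝ) {r n : ℕ} (h : n < 2 * r) : approx s r n = s n := by
  rw [approx, dif_pos h]

theorem approx_add (s : ℕ → ℝ) (r m : ℕ) :
    approx s r (2 * r + m) = ∑ k : Fin r, approx s r (r + m + (k : ℕ)) * iohvidovCoeff s r k := by
  rw [approx, dif_neg (by omega)]
  refine Finset.sum_congr rfl fun k _ => ?_
  rw [show 2 * r + m - r = r + m by omega]

/-- The rank of the infinite matrix `(t_{i+j})`, `i, j ≥ 0`: the supremum of the ranks of its
leading finite square sections. -/
def infiniteRank (t : ℕ → ℝ) : ℕ∞ := ⨆ n : ℕ, ((hankel t (n + 1)).rank : ℕ∞)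

/-- The moduli of the complex zeros of `P_r`. -/
def zeroModuli (s : ℕ → ℝ) (r : ℕ) : Set ℝ := {ρ | ∃ z : ℂ, aeval z (P s r) = 0 ∧ ‖z‖ = ρ}

/-- The Iohvidov characteristic `d_r`, equal to `∞` if `s = s^{(r)}`. -/
def characteristic (s : ℕ → ℝ) (r : ℕ) : ℕ∞ :=
  sInf ((fun m : ℕ => (m : ℕ∞)) '' {m : ℕ | s (2 * r + m) ≠ approx s r (2 * r + m)})

end HankelDet

end

namespace HankelDet

/-! ### Column elimination in block matrices -/

section Determinants

variable {R : Type*} [CommRing R]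

/-! Everything rests on one recurrence. The system defining the coefficients `d_k` says that
`s^{(r)}` satisfies its order `r` recurrence from index `r` on, not only from `2r`
(`approx_recurrence`). Hence every column of its infinite Hankel matrix is a combination of the
first `r` columns, with coefficients independent of the row. This gives the rank.

If `s` and `s^{(r)}` agree below index `2r + d`, these combinations eliminate columns in the matrix
of `D_{r+d}`. The remaining block is the Hankel matrix of `s_{2r+m} - s^{(r)}_{2r+m}` (`D_add`),
whose terms of index below `d` vanish. It is therefore zero above its antidiagonal and is evaluated
by `D_of_forall_lt_eq_zero`. So (d) and (e) reduce to (a) for the difference sequence; the `D'`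
identity is one more elimination plus Cramer's rule.

For (c), the same elimination shows that `P_r` is `D_{r-1}` times the characteristic polynomial `p`
of the recurrence, so `p` applied to the shift kills `s^{(r)}`. Splitting `p` into linear factors
bounds the growth above. For a root `z` of `p`, the cofactor `p / (X - z)` applied to the shift
sends `s^{(r)}` to a geometric sequence of ratio `z`, nonzero because `D_{r-1} ≠ 0`, which bounds
the growth below. Summing the recurrence against powers of `1/x` gives `Q_r / P_r`. -/

theorem det_fromBlocks_mul {m n : Type*} [Fintype m] [DecidableEq m] [Fintype n] [DecidableEq n]
    (A : Matrix m m R) (X : Matrix m n R) (B : Matrix n m R) (E : Matrix n n R) :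
    (Matrix.fromBlocks A (A * X) B E).det = A.det * (E - B * X).det := by
  -- A unipotent column operation clears the upper right block; `A` need not be invertible.
  have h : Matrix.fromBlocks A (A * X) B E * Matrix.fromBlocks 1 (-X) 0 1 =
      Matrix.fromBlocks A 0 B (E - B * X) := by
    rw [Matrix.fromBlocks_multiply]
    simp [sub_eq_add_neg, add_comm]
  have h2 := congrArg Matrix.det h
  rwa [Matrix.det_mul, Matrix.det_fromBlocks_zero₂₁, Matrix.det_fromBlocks_zero₁₂, Matrix.det_one,
    Matrix.det_one, one_mul, mul_one] at h2

/-- If the last `n` columns, restricted to the first `r` rows, are combinations of the first `r`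
columns, then the determinant splits. -/
theorem det_of_cols_eq_sum {r n : ℕ} (M : Matrix (Fin (r + n)) (Fin (r + n)) R)
    (X : Fin r → Fin n → R)
    (h : ∀ i j, M (Fin.castAdd n i) (Fin.natAdd r j) =
      ∑ k, M (Fin.castAdd n i) (Fin.castAdd n k) * X k j) :
    M.det = (Matrix.of fun i j => M (Fin.castAdd n i) (Fin.castAdd n j)).det *
      (Matrix.of fun i j => M (Fin.natAdd r i) (Fin.natAdd r j) -
        ∑ k, M (Fin.natAdd r i) (Fin.castAdd n k) * X k j).det := by
  have h1 : M.submatrix finSumFinEquiv finSumFinEquiv = Matrix.fromBlocks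
      (Matrix.of fun i j => M (Fin.castAdd n i) (Fin.castAdd n j))
      ((Matrix.of fun i j => M (Fin.castAdd n i) (Fin.castAdd n j)) * Matrix.of X)
      (Matrix.of fun i j => M (Fin.natAdd r i) (Fin.castAdd n j))
      (Matrix.of fun i j => M (Fin.natAdd r i) (Fin.natAdd r j)) := by
    ext (i | i) (j | j)
    · simp
    · simp [Matrix.mul_apply, h]
    · simp
    · simp
  rw [← Matrix.det_submatrix_equiv_self finSumFinEquiv M, h1, det_fromBlocks_mul]
  rfl

theorem det_of_last_col_eq_sum {r : ℕ} (M : Matrix (Fin (r + 1)) (Fin (r + 1)) R) (x : Fin r → R)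
    (h : ∀ i : Fin r, M i.castSucc (Fin.last r) = ∑ k : Fin r, M i.castSucc k.castSucc * x k) :
    M.det = (Matrix.of fun i j : Fin r => M i.castSucc j.castSucc).det *
      (M (Fin.last r) (Fin.last r) - ∑ k : Fin r, M (Fin.last r) k.castSucc * x k) := by
  rw [det_of_cols_eq_sum (r := r) (n := 1) M (fun k _ => x k)]
  · rw [Matrix.det_fin_one]
    rfl
  · intro i j
    rw [Subsingleton.elim j 0]
    exact h i

end Determinants

/-! ### Hankel determinants with vanishing initial terms -/

theorem neg_one_pow_triangle_succ (n : ℕ) :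
    (-1 : ℝ) ^ ((n + 1) * (n + 1 + 1) / 2) = (-1) ^ (n + 1) * (-1) ^ (n * (n + 1) / 2) := by
  rw [← pow_add]
  congr 1
  rw [show (n + 1) * (n + 1 + 1) = n * (n + 1) + (n + 1) * 2 by ring, Nat.add_mul_div_right _ _ two_pos,
    add_comm]

/-- The matrix vanishes above the antidiagonal, so row zero has only its last entry; the
corresponding minor is the Hankel matrix of the once-shifted sequence. -/
theorem D_of_forall_lt_eq_zero (n : ℕ) (s : ℕ → ℝ) (h : ∀ i < n, s i = 0) :
    D s n = (-1) ^ (n * (n + 1) / 2) * s n ^ (n + 1) := by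
  induction n generalizing s with
  | zero => simp [D, hankel]
  | succ n ih =>
    have ih' := ih (fun i => s (i + 1)) (fun i hi => h _ (by omega))
    rw [D, Matrix.det_succ_row_zero, Fin.sum_univ_castSucc, Finset.sum_eq_zero, zero_add,
      neg_one_pow_triangle_succ, pow_succ (s (n + 1))]
    · have hs : ((hankel s (n + 1 + 1)).submatrix Fin.succ (Fin.last (n + 1)).succAbove) =
          hankel (fun i => s (i + 1)) (n + 1) := by
        ext i j
        simp only [hankel, Matrix.submatrix_apply, Matrix.of_apply, Fin.succAbove_last,
          Fin.val_succ, Fin.val_castSucc]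
        congr 1
        omega
      rw [hs]
      rw [D] at ih'
      rw [ih']
      simp only [hankel, Matrix.of_apply, Fin.val_zero, Fin.val_last, zero_add]
      ring
    · intro j _
      simp [hankel, h j j.2]

theorem forall_lt_D_eq_zero_iff (s : ℕ → ℝ) (n : ℕ) :
    (∀ i < n, D s i = 0) ↔ ∀ i < n, s i = 0 := by
  induction n with
  | zero => simp
  | succ n ih =>
    rw [Nat.forall_lt_succ_right, Nat.forall_lt_succ_right, ih]
    refine and_congr_right fun h => ?_
    rw [D_of_forall_lt_eq_zero n s h]
    simp

theorem D_eq_hankel_det {s : ℕ → ℝ} {r : ℕ} (hr : 1 ≤ r) : D s (r - 1) = (hankel s r).det := by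
  obtain ⟨m, rfl⟩ : ∃ m, r = m + 1 := ⟨r - 1, by omega⟩
  rfl

theorem indexSet_nonempty {s : ℕ → ℝ} (hs : s ≠ 0) : (indexSet s).Nonempty := by
  by_contra h
  apply hs
  funext n
  refine (forall_lt_D_eq_zero_iff s (n + 1)).1 (fun i _ => ?_) n (Nat.lt_succ_self n)
  by_contra hD
  exact h ⟨i + 1, by omega, hD⟩

/-! ### The approximating sequence: rank and determinants -/

section Approx

variable {s : ℕ → ℝ} {r : ℕ}

theorem approx_recurrence (hr : r ∈ indexSet s) (m : ℕ) :
    approx s r (r + m) = ∑ k : Fin r, approx s r (m + k) * iohvidovCoeff s r k := by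
  rcases lt_or_ge m r with hm | hm
  · rw [approx_of_lt s (by omega), ← (iohvidovCoeff_unique s hr _).2 rfl ⟨m, hm⟩]
    refine Finset.sum_congr rfl fun k _ => ?_
    rw [approx_of_lt s (by have := k.2; omega)]
  · obtain ⟨a, rfl⟩ := Nat.exists_eq_add_of_le hm
    rw [← approx_add, two_mul, add_assoc]

/-- The point is that `b` does not depend on the row `i`, so one column relation serves every finite
section. -/
theorem exists_approx_add_eq_sum (hr : r ∈ indexSet s) (j : ℕ) :
    ∃ b : Fin r → ℝ, ∀ i, approx s r (i + j) = ∑ k : Fin r, approx s r (i + k) * b k := by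
  induction j using Nat.strong_induction_on with
  | _ j ih =>
    rcases lt_or_ge j r with hj | hj
    · refine ⟨Pi.single ⟨j, hj⟩ 1, fun i => ?_⟩
      rw [Finset.sum_eq_single ⟨j, hj⟩] <;> simp +contextual
    · have h : ∀ k : Fin r, ∃ b : Fin r → ℝ, ∀ i, approx s r (i + (j - r + k)) =
          ∑ l : Fin r, approx s r (i + l) * b l := fun k => ih _ (by have := k.2; omega)
      choose b hb using h
      refine ⟨fun l => ∑ k, b k l * iohvidovCoeff s r k, fun i => ?_⟩
      rw [show i + j = r + (i + (j - r)) by omega, approx_recurrence hr]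
      simp_rw [add_assoc i, hb, Finset.sum_mul, Finset.mul_sum]
      rw [Finset.sum_comm]
      simp_rw [mul_assoc]

theorem hankel_approx (s : ℕ → ℝ) (r : ℕ) : hankel (approx s r) r = hankel s r := by
  ext i j
  exact approx_of_lt s (by have := i.2; have := j.2; omega)

theorem infiniteRank_approx (hr : r ∈ indexSet s) : infiniteRank (approx s r) = r := by
  apply le_antisymm
  · refine iSup_le fun n => ?_
    choose b hb using exists_approx_add_eq_sum hr
    have h : hankel (approx s r) (n + 1) =
        (Matrix.of fun (i : Fin (n + 1)) (k : Fin r) => approx s r (i + k)) *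
          (Matrix.of fun (k : Fin r) (j : Fin (n + 1)) => b j k) := by
      ext i j
      simp only [hankel, Matrix.mul_apply, Matrix.of_apply]
      exact hb _ _
    rw [h]
    exact Nat.cast_le.2 ((Matrix.rank_mul_le_left _ _).trans (Matrix.rank_le_width _))
  · obtain ⟨h1, h2⟩ := hr
    refine le_trans ?_ (le_iSup _ (r - 1))
    rw [Nat.sub_add_cancel h1, hankel_approx, Matrix.rank_of_isUnit]
    · simp
    · rw [Matrix.isUnit_iff_isUnit_det, ← D_eq_hankel_det h1]
      exact isUnit_iff_ne_zero.2 h2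

/-- Entries of `s` in the first `r` rows or first `r` columns have index below `2r + d`, so there
the column relations of `approx s r` apply to `s`. Only in the lower right block can the two
sequences differ. -/
theorem D_add (hr : r ∈ indexSet s) (d : ℕ)
    (h : ∀ i < d, s (2 * r + i) = approx s r (2 * r + i)) :
    D s (r + d) = D s (r - 1) * D (fun m => s (2 * r + m) - approx s r (2 * r + m)) d := by
  have hst : ∀ n < 2 * r + d, s n = approx s r n := by
    intro n hn
    rcases lt_or_ge n (2 * r) with h1 | h1
    · rw [approx_of_lt s h1]
    · obtain ⟨a, rfl⟩ := Nat.exists_eq_add_of_le h1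
      exact h a (by omega)
  choose b hb using exists_approx_add_eq_sum hr
  rw [D_eq_hankel_det hr.1]
  refine (det_of_cols_eq_sum (r := r) (n := d + 1) (hankel s (r + (d + 1)))
    (fun k j => b (r + j) k) fun i j => ?_).trans ?_
  · simp only [hankel, Matrix.of_apply, Fin.val_castAdd, Fin.val_natAdd]
    rw [hst _ (by omega), hb]
    refine Finset.sum_congr rfl fun k _ => ?_
    rw [hst _ (by omega)]
  · congr 1
    rw [D]
    congr 1
    ext i j
    simp only [hankel, Matrix.of_apply, Fin.val_castAdd, Fin.val_natAdd]
    rw [show r + (i : ℕ) + (r + j) = 2 * r + (i + j) by ring]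
    congr 1
    rw [show 2 * r + ((i : ℕ) + j) = r + i + (r + j) by ring, hb]
    refine Finset.sum_congr rfl fun k _ => ?_
    rw [hst _ (by omega)]

theorem forall_lt_D_add_eq_zero_iff (hr : r ∈ indexSet s) (d : ℕ) :
    (∀ i < d, D s (r + i) = 0) ↔ ∀ i < d, s (2 * r + i) = approx s r (2 * r + i) := by
  induction d with
  | zero => simp
  | succ d ih =>
    rw [Nat.forall_lt_succ_right, Nat.forall_lt_succ_right, ih]
    refine and_congr_right fun h => ?_
    rw [D_add hr d h, D_of_forall_lt_eq_zero d _ fun i hi => sub_eq_zero.2 (h i hi)]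
    simp [hr.2, sub_eq_zero]

theorem D_add_eq (hr : r ∈ indexSet s) (d : ℕ) (h : ∀ i < d, D s (r + i) = 0) :
    D s (r + d) = (-1) ^ (d * (d + 1) / 2) *
      (s (2 * r + d) - approx s r (2 * r + d)) ^ (d + 1) * D s (r - 1) := by
  rw [forall_lt_D_add_eq_zero_iff hr] at h
  rw [D_add hr d h, D_of_forall_lt_eq_zero d _ fun i hi => sub_eq_zero.2 (h i hi)]
  ring

/-- Cramer's rule: the minor is the matrix of the linear system with its last column replaced by the
right-hand side. -/
theorem D'_eq_mul {q : ℕ} (hr : q + 1 ∈ indexSet s) :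
    D' s (q + 1) = iohvidovCoeff s (q + 1) (Fin.last q) * D s q := by
  have hu : IsUnit (hankel s (q + 1)).det := isUnit_iff_ne_zero.2 hr.2
  have h := congrFun (Matrix.cramer_eq_adjugate_mulVec (hankel s (q + 1))
    fun i => s (q + 1 + i)) (Fin.last q)
  rw [Matrix.cramer_apply] at h
  rw [iohvidovCoeff, Matrix.inv_def, Matrix.smul_mulVec, Pi.smul_apply, ← h, D, smul_eq_mul,
    Ring.inverse_eq_inv', mul_comm, mul_inv_cancel_left₀ hu.ne_zero, D']
  congr 1
  ext i j
  induction j using Fin.lastCases with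
  | last =>
    simp only [hankel, Matrix.submatrix_apply, Matrix.of_apply, Fin.succAbove_last,
      Matrix.updateCol_self, Fin.val_castSucc]
    rw [Fin.succAbove_of_le_castSucc _ _ le_rfl]
    simp [add_comm]
  | cast j =>
    rw [Matrix.updateCol_ne (Fin.castSucc_lt_last j).ne]
    simp only [hankel, Matrix.submatrix_apply, Matrix.of_apply, Fin.succAbove_last,
      Fin.val_castSucc]
    rw [Fin.succAbove_of_castSucc_lt _ _ (by simp [Fin.lt_def])]
    simp

theorem D'_succ (hr : r ∈ indexSet s) :
    D' s (r + 1) = (s (2 * r + 1) - approx s r (2 * r + 1)) * D s (r - 1) -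
      (s (2 * r) - approx s r (2 * r)) * D' s r := by
  obtain ⟨q, rfl⟩ : ∃ q, r = q + 1 := ⟨r - 1, by have := hr.1; omega⟩
  -- After transposing, the omitted column becomes an omitted row, and the last column is the
  -- right-hand side of the linear system on the first `r` rows.
  rw [D'_eq_mul hr, D', ← Matrix.det_transpose,
    det_of_last_col_eq_sum _ (iohvidovCoeff s (q + 1)) fun i => ?_]
  · have hA : (Matrix.of fun i j : Fin (q + 1) => ((hankel s (q + 1 + 2)).submatrix
        (Fin.last (q + 1 + 1)).succAbove (Fin.last (q + 1)).castSucc.succAbove).transpose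
          i.castSucc j.castSucc) = hankel s (q + 1) := by
      ext i j
      simp only [Matrix.of_apply, Matrix.transpose_apply, Matrix.submatrix_apply, hankel,
        Fin.succAbove_last, Fin.val_castSucc]
      rw [Fin.succAbove_of_castSucc_lt _ _ (by simp [Fin.lt_def]; omega)]
      simp [add_comm]
    rw [hA, show (hankel s (q + 1)).det = D s q from rfl, Nat.add_sub_cancel]
    simp only [Matrix.transpose_apply, Matrix.submatrix_apply, hankel, Matrix.of_apply,
        Fin.succAbove_last, Fin.val_castSucc, Fin.val_last]
    rw [Fin.succAbove_of_le_castSucc _ _ le_rfl, approx_add, Fin.sum_univ_castSucc,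
      Fin.sum_univ_castSucc]
    -- In the recurrence for index `2r + 1` only the last term, of index `2r`, can differ from `s`;
    -- it produces the `D'_r` correction.
    have hsum : ∀ k : Fin q, approx s (q + 1) (q + 1 + 1 + k) =
        s (k + (q + 1 + 1)) := fun k => by
      rw [approx_of_lt s (by omega), add_comm]
    simp only [Fin.val_succ, Fin.val_last, Fin.val_castSucc, hsum]
    rw [show q + 1 + (q + 1 + 1) = 2 * (q + 1) + 1 by ring,
      show q + (q + 1 + 1) = 2 * (q + 1) by ring, show q + 1 + 1 + q = 2 * (q + 1) by ring]
    ring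
  · simp only [Matrix.transpose_apply, Matrix.submatrix_apply, hankel, Matrix.of_apply,
        Fin.succAbove_last, Fin.val_castSucc, Fin.val_last]
    rw [Fin.succAbove_of_castSucc_lt _ _ (by simp [Fin.lt_def]; omega)]
    simp only [Fin.val_castSucc]
    rw [← (iohvidovCoeff_unique s hr _).2 rfl i]
    simp_rw [add_comm]

theorem eq_approx_iff : s = approx s r ↔ ∀ m, s (2 * r + m) = approx s r (2 * r + m) := by
  refine ⟨fun h m => congrFun h _, fun h => funext fun n => ?_⟩
  rcases lt_or_ge n (2 * r) with h1 | h1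
  · rw [approx_of_lt s h1]
  · obtain ⟨a, rfl⟩ := Nat.exists_eq_add_of_le h1
    exact h a

theorem eq_approx_iff_D (hr : r ∈ indexSet s) : s = approx s r ↔ ∀ n ≥ r, D s n = 0 := by
  rw [eq_approx_iff]
  constructor
  · intro h n hn
    obtain ⟨a, rfl⟩ := Nat.exists_eq_add_of_le hn
    exact (forall_lt_D_add_eq_zero_iff hr (a + 1)).2 (fun i _ => h i) a (Nat.lt_succ_self a)
  · intro h m
    exact (forall_lt_D_add_eq_zero_iff hr (m + 1)).1 (fun i _ => h _ (by omega)) m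
      (Nat.lt_succ_self m)

theorem characteristic_eq_top_iff : characteristic s r = ⊤ ↔ s = approx s r := by
  rw [eq_approx_iff, characteristic, sInf_eq_top]
  simp

end Approx

theorem sInf_natCast_image_le {A B : Set ℕ} (h : ∀ d, (∀ i < d, i ∉ A) → ∀ i < d, i ∉ B) :
    sInf ((fun m : ℕ => (m : ℕ∞)) '' A) ≤ sInf ((fun m : ℕ => (m : ℕ∞)) '' B) := by
  refine le_sInf ?_
  rintro _ ⟨m, hm, rfl⟩
  by_contra! hlt
  refine h (m + 1) (fun i hi hA => ?_) m (Nat.lt_succ_self m) hm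
  refine absurd (lt_of_lt_of_le hlt (sInf_le ⟨i, hA, rfl⟩)) (not_lt.2 ?_)
  exact Nat.cast_le.2 (by omega)

theorem characteristic_eq {s : ℕ → ℝ} {r : ℕ} (hr : r ∈ indexSet s) :
    characteristic s r = sInf ((fun m : ℕ => (m : ℕ∞)) '' {m : ℕ | D s (r + m) ≠ 0}) := by
  have key := forall_lt_D_add_eq_zero_iff hr
  exact le_antisymm
    (sInf_natCast_image_le fun d => by simpa using (key d).2)
    (sInf_natCast_image_le fun d => by simpa using (key d).1)

/-! ### Growth of sequences annihilated by a polynomial in the shift -/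

open Filter Asymptotics

/-- The left shift on complex sequences. -/
noncomputable def shift : Module.End ℂ (ℕ → ℂ) := LinearMap.funLeft ℂ ℂ Nat.succ

theorem shift_apply (w : ℕ → ℂ) (m : ℕ) : shift w m = w (m + 1) := rfl

theorem shift_pow_apply (j : ℕ) (w : ℕ → ℂ) (m : ℕ) : (shift ^ j) w m = w (m + j) := by
  induction j generalizing w with
  | zero => simp
  | succ j ih => rw [pow_succ, Module.End.mul_apply, ih, shift_apply, add_assoc]

theorem aeval_shift_apply {q : ℂ[X]} {n : ℕ} (hn : q.natDegree < n) (w : ℕ → ℂ) (m : ℕ) :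
    aeval shift q w m = ∑ j ∈ Finset.range n, q.coeff j * w (m + j) := by
  rw [aeval_eq_sum_range' hn, LinearMap.sum_apply, Finset.sum_apply]
  simp [shift_pow_apply]

theorem isBigO_pow_of_shift_sub {z : ℂ} {M : ℝ} (hM : ‖z‖ < M) {w : ℕ → ℂ}
    (h : (fun m => w (m + 1) - z * w m) =O[atTop] fun m => M ^ m) :
    w =O[atTop] fun m => M ^ m := by
  have hM0 : 0 < M := (norm_nonneg z).trans_lt hM
  obtain ⟨c, hc, hb⟩ := bound_of_isBigO_nat_atTop h
  -- Chosen so that `c + ‖z‖ * K ≤ M * K`, which closes the induction.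
  set K := max ‖w 0‖ (c / (M - ‖z‖)) with hK
  have hcK : c ≤ K * (M - ‖z‖) := (div_le_iff₀ (by linarith)).1 (le_max_right _ _)
  refine IsBigO.of_bound K (Eventually.of_forall fun m => ?_)
  rw [Real.norm_of_nonneg (by positivity)]
  induction m with
  | zero => simp [hK]
  | succ m ih =>
    have h1 := hb (pow_pos hM0 m).ne'
    rw [Real.norm_of_nonneg (by positivity)] at h1
    calc ‖w (m + 1)‖ = ‖(w (m + 1) - z * w m) + z * w m‖ := by ring_nf
      _ ≤ ‖w (m + 1) - z * w m‖ + ‖z‖ * ‖w m‖ := (norm_add_le _ _).trans (by rw [norm_mul])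
      _ ≤ K * (M - ‖z‖) * M ^ m + ‖z‖ * (K * M ^ m) := by gcongr; exact h1.trans (by gcongr)
      _ = K * M ^ (m + 1) := by ring

theorem isBigO_pow_of_aeval_shift_eq_zero (Z : Multiset ℂ) {M : ℝ} (hZ : ∀ z ∈ Z, ‖z‖ < M)
    (w : ℕ → ℂ) (h : aeval shift (Z.map fun z => X - C z).prod w = 0) :
    w =O[atTop] fun m => M ^ m := by
  -- Weakening "zero" to "`O(M ^ m)`" lets the linear factors be removed one at a time.
  suffices H : ∀ w : ℕ → ℂ, (aeval shift (Z.map fun z => X - C z).prod w =O[atTop]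
      fun m => M ^ m) → w =O[atTop] fun m => M ^ m from
    H w (by rw [h]; exact isBigO_zero _ _)
  clear h w
  induction Z using Multiset.induction_on with
  | empty => intro w h; simpa using h
  | cons z Z ih =>
    intro w h
    rw [Multiset.map_cons, Multiset.prod_cons, mul_comm, map_mul, Module.End.mul_apply] at h
    have h1 := ih (fun y hy => hZ y (Multiset.mem_cons_of_mem hy)) _ h
    refine isBigO_pow_of_shift_sub (hZ z (Multiset.mem_cons_self z Z)) ?_
    convert h1 using 1
    funext m
    simp [shift_apply]

theorem isBigO_pow_shift {w : ℕ → ℂ} {M : ℝ} (h : w =O[atTop] fun m => M ^ m) (j : ℕ) :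
    (fun m => w (m + j)) =O[atTop] fun m => M ^ m := by
  refine (h.comp_tendsto (tendsto_add_atTop_nat j)).trans ?_
  have : ((fun m => M ^ m) ∘ fun m => m + j) = fun m => M ^ j * M ^ m := by
    funext m
    simp [pow_add, mul_comm]
  rw [this]
  exact (isBigO_refl _ _).const_mul_left _

theorem isBigO_pow_aeval_shift {w : ℕ → ℂ} {M : ℝ} (h : w =O[atTop] fun m => M ^ m) (q : ℂ[X]) :
    aeval shift q w =O[atTop] fun m => M ^ m := by
  have : aeval shift q w = fun m => ∑ j ∈ Finset.range (q.natDegree + 1), q.coeff j * w (m + j) :=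
    funext fun m => aeval_shift_apply (Nat.lt_succ_self _) w m
  rw [this]
  exact IsBigO.fun_sum fun j _ => (isBigO_pow_shift h j).const_mul_left _

theorem not_isBigO_pow_of_geometric {z : ℂ} {M : ℝ} (h0 : 0 ≤ M) (hM : M < ‖z‖) {w : ℕ → ℂ}
    (hw : shift w = z • w) (hw0 : w ≠ 0) : ¬ w =O[atTop] fun m => M ^ m := by
  intro h
  have hgeo : ∀ m, w m = w 0 * z ^ m := by
    intro m
    induction m with
    | zero => simp
    | succ m ih => rw [← shift_apply w m, hw, Pi.smul_apply, ih, smul_eq_mul, pow_succ]; ring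
  have hne : w 0 ≠ 0 := fun h0 => hw0 (funext fun m => by rw [hgeo, h0, zero_mul]; rfl)
  have h1 : (fun m => z ^ m) =O[atTop] fun m => M ^ m := by
    rw [← isBigO_const_mul_left_iff hne]
    exact h.congr_left hgeo
  have h2 : (fun m => M ^ m) =o[atTop] fun m => z ^ m := by
    rw [← isLittleO_norm_right]
    simp_rw [norm_pow]
    exact isLittleO_pow_pow_of_lt_left h0 hM
  have h3 := h1.trans_isLittleO h2
  obtain ⟨m, hm⟩ := ((h3.def (show (0:ℝ) < 1 / 2 by norm_num))).exists
  have : 0 < ‖z ^ m‖ := norm_pos_iff.2 (pow_ne_zero _ (norm_pos_iff.1 (h0.trans_lt hM)))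
  linarith

section RootTest

variable {t : ℕ → ℝ} {ρ : ℝ}

/-- Only `M > ρ` is assumed, since multiple roots of largest modulus may contribute polynomial
factors. -/
theorem limsup_root_le (hρ : 0 ≤ ρ)
    (h : ∀ M > ρ, (fun k => (t k : ℂ)) =O[atTop] fun k => M ^ k) :
    limsup (fun k : ℕ => ENNReal.ofReal (|t k| ^ ((1 : ℝ) / (k : ℝ)))) atTop ≤
      ENNReal.ofReal ρ := by
  refine le_of_forall_gt_imp_ge_of_dense fun b hb => ?_
  rcases eq_or_ne b ⊤ with rfl | hbt
  · exact le_top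
  have hb1 : ρ < b.toReal := (ENNReal.ofReal_lt_iff_lt_toReal hρ hbt).1 hb
  obtain ⟨M, hM1, hM2⟩ := exists_between hb1
  -- The gap between `M` and `b` absorbs the implied constant.
  have h1 := (h M hM1).trans_isLittleO
    (isLittleO_pow_pow_of_lt_left (hρ.trans hM1.le) hM2)
  refine limsup_le_of_le (by isBoundedDefault) ?_
  filter_upwards [h1.def one_pos, eventually_ne_atTop 0] with k hk hk0
  rw [← ENNReal.ofReal_toReal hbt]
  apply ENNReal.ofReal_le_ofReal
  rw [one_mul, Complex.norm_real, norm_pow, Real.norm_eq_abs, Real.norm_eq_abs,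
    abs_of_nonneg ENNReal.toReal_nonneg] at hk
  rw [one_div]
  exact (Real.rpow_le_rpow (abs_nonneg _) hk (by positivity)).trans_eq
    (Real.pow_rpow_inv_natCast ENNReal.toReal_nonneg hk0)

theorem le_limsup_root
    (h : ∀ M, 0 ≤ M → M < ρ → ¬ (fun k => (t k : ℂ)) =O[atTop] fun k => M ^ k) :
    ENNReal.ofReal ρ ≤
      limsup (fun k : ℕ => ENNReal.ofReal (|t k| ^ ((1 : ℝ) / (k : ℝ)))) atTop := by
  by_contra! hlt
  obtain ⟨b, hb1, hb2⟩ := exists_between hlt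
  have hbt : b ≠ ⊤ := (hb2.trans ENNReal.ofReal_lt_top).ne
  refine h b.toReal ENNReal.toReal_nonneg ((ENNReal.lt_ofReal_iff_toReal_lt hbt).1 hb2) ?_
  refine IsBigO.of_bound 1 ?_
  filter_upwards [eventually_lt_of_limsup_lt hb1, eventually_ne_atTop 0] with k hk hk0
  have h1 := (ENNReal.ofReal_lt_iff_lt_toReal (by positivity) hbt).1 hk
  rw [one_mul, Complex.norm_real, norm_pow, Real.norm_eq_abs, Real.norm_eq_abs,
    abs_of_nonneg ENNReal.toReal_nonneg]
  rw [one_div] at h1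
  exact (Real.rpow_inv_natCast_pow (abs_nonneg (t k)) hk0).symm.trans_le
    (pow_le_pow_left₀ (by positivity) h1.le k)

end RootTest

theorem summable_norm_div_pow {w : ℕ → ℂ} {M : ℝ} (h0 : 0 ≤ M) {x : ℂ} (hx : M < ‖x‖)
    (h : w =O[atTop] fun k => M ^ k) : Summable fun k : ℕ => ‖w k / x ^ (k + 1)‖ := by
  have hx0 : 0 < ‖x‖ := h0.trans_lt hx
  refine summable_of_isBigO_nat (g := fun k => (M / ‖x‖) ^ k)
    (summable_geometric_of_lt_one (by positivity) ((div_lt_one hx0).2 hx)) ?_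
  have h1 : (fun k => w k / x ^ (k + 1)) =O[atTop] fun k => M ^ k * ((x ^ (k + 1))⁻¹) := by
    simp_rw [div_eq_mul_inv, ← Complex.ofReal_pow]
    exact (Complex.isBigO_ofReal_right.2 h).mul (isBigO_refl (fun k => (x ^ (k + 1))⁻¹) _)
  refine (h1.norm_left).trans (IsBigO.of_bound ‖x‖⁻¹ (Eventually.of_forall fun k => le_of_eq ?_))
  simp [pow_succ, div_pow, abs_of_nonneg h0]
  field_simp

/-! ### Characteristic polynomial, root modulus and generating function -/

section Pade

variable {s : ℕ → ℝ} {r : ℕ}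

/-- The last row is left arbitrary so that one elimination covers both `P` and `Q`. -/
theorem det_hankel_updateLastRow (hr : r ∈ indexSet s) (v : ℕ → ℝ[X]) :
    (Matrix.of fun i j : Fin (r + 1) =>
      if (i : ℕ) < r then C (s ((i : ℕ) + (j : ℕ))) else v j).det =
    C (D s (r - 1)) * (v r - ∑ k : Fin r, v k * C (iohvidovCoeff s r k)) := by
  rw [det_of_last_col_eq_sum _ fun k => C (iohvidovCoeff s r k)]
  · rw [D_eq_hankel_det hr.1, RingHom.map_det]
    congr 1
    · congr 1
      ext1 i j
      simp [hankel]
    · simp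
  · intro i
    have h := (iohvidovCoeff_unique s hr _).2 rfl i
    simp only [Matrix.of_apply, Fin.val_castSucc, Fin.is_lt, if_true, Fin.val_last]
    rw [add_comm, ← h, map_sum]
    simp

theorem P_eq (hr : r ∈ indexSet s) :
    P s r = C (D s (r - 1)) * (X ^ r - ∑ k : Fin r, X ^ (k : ℕ) * C (iohvidovCoeff s r k)) :=
  det_hankel_updateLastRow hr fun j => X ^ j

theorem Q_eq (hr : r ∈ indexSet s) :
    Q s r = C (D s (r - 1)) * ((∑ k ∈ Finset.range r, C (s k) * X ^ (r - 1 - k)) -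
      ∑ k : Fin r, (∑ l ∈ Finset.range k, C (s l) * X ^ ((k : ℕ) - 1 - l)) *
        C (iohvidovCoeff s r k)) :=
  det_hankel_updateLastRow hr fun j => ∑ k ∈ Finset.range j, C (s k) * X ^ (j - 1 - k)

/-- The characteristic polynomial of the recurrence satisfied by `approx s r`. -/
noncomputable def recurrencePoly (s : ℕ → ℝ) (r : ℕ) : ℂ[X] :=
  X ^ r - ∑ k : Fin r, X ^ (k : ℕ) * C (iohvidovCoeff s r k : ℂ)

theorem degree_sum_lt (s : ℕ → ℝ) (r : ℕ) :
    (∑ k : Fin r, X ^ (k : ℕ) * C (iohvidovCoeff s r k : ℂ)).degree < (r : WithBot ℕ) := by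
  refine (degree_sum_le _ _).trans_lt ((Finset.sup_lt_iff (WithBot.bot_lt_coe r)).2 fun k _ => ?_)
  rw [mul_comm]
  exact (degree_C_mul_X_pow_le _ _).trans_lt (Nat.cast_lt.2 k.2)

theorem recurrencePoly_monic (s : ℕ → ℝ) (r : ℕ) : (recurrencePoly s r).Monic :=
  monic_X_pow_sub (degree_sum_lt s r)

theorem recurrencePoly_natDegree (s : ℕ → ℝ) (r : ℕ) : (recurrencePoly s r).natDegree = r := by
  refine natDegree_eq_of_degree_eq_some ?_
  rw [recurrencePoly, degree_sub_eq_left_of_degree_lt, degree_X_pow]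
  rw [degree_X_pow]
  exact degree_sum_lt s r

theorem aeval_P (hr : r ∈ indexSet s) (z : ℂ) :
    aeval z (P s r) = (D s (r - 1) : ℂ) * (recurrencePoly s r).eval z := by
  rw [P_eq hr, recurrencePoly]
  simp [eval_finsetSum]

theorem aeval_P_eq_zero_iff (hr : r ∈ indexSet s) (z : ℂ) :
    aeval z (P s r) = 0 ↔ z ∈ (recurrencePoly s r).roots := by
  rw [aeval_P hr, mem_roots (recurrencePoly_monic s r).ne_zero, IsRoot, mul_eq_zero,
    or_iff_right (Complex.ofReal_ne_zero.2 hr.2)]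

theorem aeval_shift_recurrencePoly (hr : r ∈ indexSet s) :
    aeval shift (recurrencePoly s r) (fun k => (approx s r k : ℂ)) = 0 := by
  funext m
  have h := congrArg (fun y : ℝ => (y : ℂ)) (approx_recurrence hr m)
  simp only [Complex.ofReal_sum, Complex.ofReal_mul] at h
  simp only [recurrencePoly, map_sub, map_sum, map_mul, map_pow, aeval_X, aeval_C,
    LinearMap.sub_apply, LinearMap.sum_apply, Pi.sub_apply, Finset.sum_apply, Module.End.mul_apply,
    shift_pow_apply, Module.algebraMap_end_apply, Pi.smul_apply, smul_eq_mul, Pi.zero_apply]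
  rw [add_comm m r, h, sub_eq_zero]
  simp_rw [mul_comm]

theorem exists_isGreatest_zeroModuli (hr : r ∈ indexSet s) : ∃ ρ, IsGreatest (zeroModuli s r) ρ := by
  have h : zeroModuli s r = (fun z : ℂ => ‖z‖) '' {z | z ∈ (recurrencePoly s r).roots} := by
    ext ρ
    simp only [zeroModuli, Set.mem_ofPred_eq, Set.mem_image, aeval_P_eq_zero_iff hr]
  have hfin : {z | z ∈ (recurrencePoly s r).roots}.Finite := Multiset.finite_toSet _
  have hne : {z | z ∈ (recurrencePoly s r).roots}.Nonempty := by
    obtain ⟨z, hz⟩ := IsAlgClosed.exists_root (recurrencePoly s r) (by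
      rw [degree_eq_natDegree (recurrencePoly_monic s r).ne_zero, recurrencePoly_natDegree]
      exact_mod_cast (Nat.one_le_iff_ne_zero.1 hr.1))
    exact ⟨z, (mem_roots (recurrencePoly_monic s r).ne_zero).2 hz⟩
  obtain ⟨z, hz, hmax⟩ := Set.exists_max_image _ (fun z : ℂ => ‖z‖) hfin hne
  rw [h]
  exact ⟨‖z‖, ⟨z, hz, rfl⟩, by rintro _ ⟨y, hy, rfl⟩; exact hmax y hy⟩

theorem approx_isBigO_pow (hr : r ∈ indexSet s) {M : ℝ} (hM : ∀ ρ ∈ zeroModuli s r, ρ < M) :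
    (fun k => (approx s r k : ℂ)) =O[atTop] fun k => M ^ k := by
  refine isBigO_pow_of_aeval_shift_eq_zero (recurrencePoly s r).roots
    (fun z hz => hM _ ⟨z, (aeval_P_eq_zero_iff hr z).2 hz, rfl⟩) _ ?_
  rw [← (IsAlgClosed.splits (recurrencePoly s r)).eq_prod_roots_of_monic (recurrencePoly_monic s r)]
  exact aeval_shift_recurrencePoly hr

/-- No nonzero polynomial of degree less than `r` in the shift annihilates `approx s r`. -/
theorem aeval_shift_ne_zero (hr : r ∈ indexSet s) {q : ℂ[X]} (hq0 : q ≠ 0) (hq : q.natDegree < r) :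
    aeval shift q (fun k => (approx s r k : ℂ)) ≠ 0 := by
  intro h
  have hdet : ((hankel s r).map (algebraMap ℝ ℂ)).det ≠ 0 := by
    rw [← RingHom.mapMatrix_apply, ← RingHom.map_det, ← D_eq_hankel_det hr.1]
    exact Complex.ofReal_ne_zero.2 hr.2
  -- The first `r` terms of the annihilated sequence say that the coefficient vector lies in the
  -- kernel of the nonsingular Hankel matrix.
  have hv := Matrix.eq_zero_of_mulVec_eq_zero (v := fun j : Fin r => q.coeff j) hdet (by
    funext i
    have hi := congrFun h (i : ℕ)
    rw [aeval_shift_apply hq, Finset.sum_range] at hi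
    rw [← hankel_approx]
    refine Eq.trans ?_ hi
    simp [Matrix.mulVec, dotProduct, hankel, mul_comm])
  refine hq0 (leadingCoeff_eq_zero.1 ?_)
  exact congrFun hv ⟨q.natDegree, hq⟩

theorem approx_not_isBigO_pow (hr : r ∈ indexSet s) {z : ℂ} (hz : aeval z (P s r) = 0) {M : ℝ}
    (h0 : 0 ≤ M) (hM : M < ‖z‖) : ¬ (fun k => (approx s r k : ℂ)) =O[atTop] fun k => M ^ k := by
  intro h
  have hroot : IsRoot (recurrencePoly s r) z :=
    (mem_roots (recurrencePoly_monic s r).ne_zero).1 ((aeval_P_eq_zero_iff hr z).1 hz)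
  obtain ⟨q, hq⟩ := dvd_iff_isRoot.2 hroot
  have hq0 : q ≠ 0 := by
    rintro rfl
    exact (recurrencePoly_monic s r).ne_zero (by rw [hq, mul_zero])
  have hdeg : q.natDegree < r := by
    have := recurrencePoly_natDegree s r
    rw [hq, natDegree_mul (X_sub_C_ne_zero z) hq0, natDegree_X_sub_C] at this
    omega
  refine not_isBigO_pow_of_geometric h0 hM (w := aeval shift q fun k => (approx s r k : ℂ)) ?_
    (aeval_shift_ne_zero hr hq0 hdeg) (isBigO_pow_aeval_shift h q)
  have h1 := aeval_shift_recurrencePoly hr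
  rw [hq, map_mul, Module.End.mul_apply, map_sub, aeval_X, aeval_C, LinearMap.sub_apply,
    sub_eq_zero, Module.algebraMap_end_apply] at h1
  exact h1

theorem hasSum_shift_div_pow {w : ℕ → ℂ} {x f : ℂ} (hx : x ≠ 0)
    (h : HasSum (fun k => w k / x ^ (k + 1)) f) (j : ℕ) :
    HasSum (fun m => w (m + j) / x ^ (m + 1))
      (f * x ^ j - ∑ k ∈ Finset.range j, w k * x ^ (j - 1 - k)) := by
  have h1 := ((hasSum_nat_add_iff' j).2 h).mul_right (x ^ j)
  refine (congrArg₂ (fun g y => HasSum g y) ?_ ?_).mp h1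
  · funext m
    rw [show m + j + 1 = m + 1 + j by ring, pow_add x (m + 1) j]
    field_simp
  · rw [sub_mul, Finset.sum_mul]
    congr 1
    refine Finset.sum_congr rfl fun k hk => ?_
    have hk' := Finset.mem_range.1 hk
    rw [show x ^ j = x ^ (j - 1 - k) * x ^ (k + 1) by rw [← pow_add]; congr 1; omega]
    field_simp

theorem hasSum_approx_div_pow (hr : r ∈ indexSet s) {x : ℂ} (hx : x ≠ 0)
    (hP : aeval x (P s r) ≠ 0) (h : Summable fun k : ℕ => (approx s r k : ℂ) / x ^ (k + 1)) :
    HasSum (fun k : ℕ => (approx s r k : ℂ) / x ^ (k + 1))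
      (aeval x (Q s r) / aeval x (P s r)) := by
  obtain ⟨f, hf⟩ := h
  have hshift := hasSum_shift_div_pow (w := fun k => (approx s r k : ℂ)) hx hf
  -- Combining the shifted series with the recurrence coefficients gives the zero series, hence a
  -- linear equation for the sum `f`.
  have hsum := (hshift r).sub (hasSum_sum (s := Finset.univ) fun (k : Fin r) _ =>
    (hshift k).mul_right (iohvidovCoeff s r k : ℂ))
  have hzero : (fun m : ℕ => (approx s r (m + r) : ℂ) / x ^ (m + 1) - ∑ k : Fin r,
      (approx s r (m + k) : ℂ) / x ^ (m + 1) * (iohvidovCoeff s r k : ℂ)) = fun _ => 0 := by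
    funext m
    rw [add_comm m r, approx_recurrence hr m, Complex.ofReal_sum, Finset.sum_div, sub_eq_zero]
    refine Finset.sum_congr rfl fun k _ => ?_
    rw [Complex.ofReal_mul]
    ring
  rw [hzero] at hsum
  have heq := hsum.unique hasSum_zero
  have hs : ∀ j ≤ r, ∑ k ∈ Finset.range j, (approx s r k : ℂ) * x ^ (j - 1 - k) =
      ∑ k ∈ Finset.range j, (s k : ℂ) * x ^ (j - 1 - k) := fun j hj =>
    Finset.sum_congr rfl fun k hk => by
      rw [approx_of_lt s (by have := Finset.mem_range.1 hk; omega)]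
  rw [hs r le_rfl, Finset.sum_congr rfl fun (k : Fin r) _ => by rw [hs k k.2.le]] at heq
  convert hf using 1
  rw [div_eq_iff hP, Q_eq hr, P_eq hr]
  simp only [map_mul, map_sub, map_sum, map_pow, aeval_X, aeval_C, Complex.coe_algebraMap]
  simp only [sub_mul, Finset.sum_sub_distrib, mul_assoc, ← Finset.mul_sum] at heq ⊢
  linear_combination -(D s (r - 1) : ℂ) * heq

end Pade

end HankelDet

theorem theorem3 (s : ℕ → ℝ) (hs : s ≠ 0) :
    -- part (a)
    (∀ n : ℕ, 1 ≤ n →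
      (((∀ i < n, s i = 0) ∧ s n ≠ 0) ↔
        ((∀ i < n, HankelDet.D s i = 0) ∧ HankelDet.D s n ≠ 0)) ∧
      ((∀ i < n, HankelDet.D s i = 0) →
        HankelDet.D s n = (-1) ^ (n * (n + 1) / 2) * s n ^ (n + 1))) ∧
    -- part (b)
    ((HankelDet.indexSet s).Nonempty ∧
      ∀ r ∈ HankelDet.indexSet s, HankelDet.infiniteRank (HankelDet.approx s r) = (r : ℕ∞)) ∧
    -- part (c)
    (∀ r ∈ HankelDet.indexSet s, ∃ ρ : ℝ,
      IsGreatest (HankelDet.zeroModuli s r) ρ ∧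
      Filter.limsup
        (fun k : ℕ => ENNReal.ofReal (|HankelDet.approx s r k| ^ ((1 : ℝ) / (k : ℝ))))
        Filter.atTop = ENNReal.ofReal ρ ∧
      ∀ x : ℂ, ρ < ‖x‖ →
        Summable (fun k : ℕ => ‖(HankelDet.approx s r k : ℂ) / x ^ (k + 1)‖) ∧
        HasSum (fun k : ℕ => (HankelDet.approx s r k : ℂ) / x ^ (k + 1))
          (Polynomial.aeval x (HankelDet.Q s r) / Polynomial.aeval x (HankelDet.P s r))) ∧
    -- part (d)
    (∀ r ∈ HankelDet.indexSet s,
      HankelDet.D s r =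
        (s (2 * r) - HankelDet.approx s r (2 * r)) * HankelDet.D s (r - 1) ∧
      HankelDet.D' s (r + 1) =
        (s (2 * r + 1) - HankelDet.approx s r (2 * r + 1)) * HankelDet.D s (r - 1) -
          (s (2 * r) - HankelDet.approx s r (2 * r)) * HankelDet.D' s r ∧
      ∀ d : ℕ, 1 ≤ d →
        ((∀ i < d, HankelDet.D s (r + i) = 0) ↔
          ∀ i < d, s (2 * r + i) = HankelDet.approx s r (2 * r + i)) ∧
        ((∀ i < d, HankelDet.D s (r + i) = 0) →
          HankelDet.D s (r + d) = (-1) ^ (d * (d + 1) / 2) *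
            (s (2 * r + d) - HankelDet.approx s r (2 * r + d)) ^ (d + 1) *
              HankelDet.D s (r - 1))) ∧
    -- part (e)
    (∀ r ∈ HankelDet.indexSet s,
      HankelDet.characteristic s r =
        sInf ((fun m : ℕ => (m : ℕ∞)) '' {m : ℕ | HankelDet.D s (r + m) ≠ 0}) ∧
      (HankelDet.characteristic s r = ⊤ ↔ s = HankelDet.approx s r) ∧
      (s = HankelDet.approx s r ↔
        HankelDet.D s (r - 1) ≠ 0 ∧ ∀ n ≥ r, HankelDet.D s n = 0)) := by
  refine ⟨fun n hn => ⟨?_, fun h => ?_⟩, ⟨HankelDet.indexSet_nonempty hs, fun r hr =>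
    HankelDet.infiniteRank_approx hr⟩, fun r hr => ?_, fun r hr => ⟨?_, HankelDet.D'_succ hr,
    fun d _ => ⟨HankelDet.forall_lt_D_add_eq_zero_iff hr d, HankelDet.D_add_eq hr d⟩⟩,
    fun r hr => ⟨HankelDet.characteristic_eq hr, HankelDet.characteristic_eq_top_iff, ?_⟩⟩
  · rw [HankelDet.forall_lt_D_eq_zero_iff]
    refine and_congr_right fun h => ?_
    rw [HankelDet.D_of_forall_lt_eq_zero n s h]
    simp
  · exact HankelDet.D_of_forall_lt_eq_zero n s ((HankelDet.forall_lt_D_eq_zero_iff s n).1 h)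
  · obtain ⟨ρ, hρ⟩ := HankelDet.exists_isGreatest_zeroModuli hr
    obtain ⟨z, hz, rfl⟩ := hρ.1
    have hO : ∀ M > ‖z‖, (fun k => (HankelDet.approx s r k : ℂ)) =O[Filter.atTop]
        fun k => M ^ k := fun M hM =>
      HankelDet.approx_isBigO_pow hr fun y hy => (hρ.2 hy).trans_lt hM
    refine ⟨‖z‖, hρ, le_antisymm (HankelDet.limsup_root_le (norm_nonneg z) hO)
      (HankelDet.le_limsup_root fun M h0 hM => HankelDet.approx_not_isBigO_pow hr hz h0 hM),
      fun x hx => ?_⟩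
    obtain ⟨M, hM1, hM2⟩ := exists_between hx
    have hsum := HankelDet.summable_norm_div_pow ((norm_nonneg z).trans hM1.le) hM2 (hO M hM1)
    refine ⟨hsum, HankelDet.hasSum_approx_div_pow hr
      (norm_pos_iff.1 ((norm_nonneg z).trans_lt hx)) (fun h0 => ?_) hsum.of_norm⟩
    exact (hρ.2 ⟨x, h0, rfl⟩).not_gt hx
  · have h := HankelDet.D_add_eq hr 0 (by simp)
    simpa using h
  · rw [HankelDet.eq_approx_iff_D hr, and_iff_right hr.2]
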